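/- An alphabet is a finite non-empty set $A$, and $A^*$ is the free monoid of words over $A$. Let $\mathbf{Free.Mon}$ be the category of all free monoids $A^*$ over alphabets and all monoid homomorphisms between them, and let $\mathbf{C}$ be a subcategory of $\mathbf{Free.Mon}$ that contains all its objects (but not necessarily all morphisms). A $\mathbf{C}$-variety of regular languages $\mathcal V$ is a class of regular languages such that, with $\mathcal V_A=\{L\subseteq A^*\mid L\in\mathcal V\}$, for all alphabets $A,B$: $\emptyset,A^*\in\mathcal V_A$; $\mathcal V_A$ is closed under union, intersection, complement and the quotients $w^{-1}L=\{u\mid wu\in L\}$ and $Lw^{-1}=\{u\mid uw\in L\}$ ($w\in A^*$); and $f^{-1}L\in\mathcal V_A$ whenever $L\in\mathcal V_B$ and $f:A^*\to B^*$ is in $\mathbf{C}$. A finite stamp over $A$ is a surjective homomorphism $s:A^*\twoheadrightarrow M$ onto a finite monoid. A $\mathbf{C}$-variety of finite stamps $\mathbf V$ is a class of finite stamps such that, with $\mathbf V_A$ the class of its members over $A$: $A^*\twoheadrightarrow 1$ is in $\mathbf V_A$ for every $A$; for $s:A^*\twoheadrightarrow M$, $t:A^*\twoheadrightarrow N$ in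 $\mathbf V_A$, the corestriction $s*t$ of $\langle s,t\rangle:A^*\to M\times N$ to its image is in $\mathbf V_A$; $h\circ s\in\mathbf V_A$ for $s\in \mathbf V_A$ and every surjective homomorphism $h$ out of $M$; and if $t:B^*\twoheadrightarrow N$ is in $\mathbf V_B$, $f:A^*\to B^*$ is in $\mathbf{C}$ and $s:A^*\twoheadrightarrow M$ satisfies $j\circ s=t\circ f$ for an injective homomorphism $j:M\to N$, then $s\in\mathbf V_A$. A finite action over $A$ is a right action $S\times A^*\to S$, $(\xi,u)\mapsto \xi\cdot u$, of the monoid $A^*$ on a finite (possibly empty) set $S$. A $\mathbf{C}$-variety of finite actions $\mathscr V$ is a class of finite actions that contains all trivial actions ($\xi\cdot u=\xi$ for all $\xi,u$), is closed under binary products, subactions and quotients (images under surjective equivariant maps) over each fixed alphabet, and is such that for every $S\times B^*\to S$ in $\mathscr V$ and $f:A^*\to B^*$ in $\mathbf{C}$ the action $\xi\cdot u:=\xi\cdot f(u)$ of $A^*$ on $S$ is in $\mathscr V$. Let $\mathfrak R$, $\mathfrak M$ and $\mathfrak D$ be the lattices of $\mathbf{C}$-varieties of regular languages, of finite stamps and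 of finite actions, respectively, ordered by inclusion. **Theorem.** There are canonical isomorphisms of lattices $\Phi:\mathfrak R\xrightarrow{\ \sim\ }\mathfrak M$ and $\Psi:\mathfrak M\xrightarrow{\ \sim\ }\mathfrak D$. They are given by syntactic monoids, transformation monoids and recognized languages, as follows, for every alphabet $A$: 1. a stamp $s:A^*\twoheadrightarrow M$ is in $\Phi(\mathcal V)$ if and only if $s^{-1}(P)\in\mathcal V$ for every $P\subseteq M$; 2. a language $L\subseteq A^*$ is in $\Phi^{-1}(\mathbf V)$ if and only if the projection of $A^*$ onto the syntactic monoid of $L$ is (up to isomorphism) a stamp in $\mathbf V$, and also if and only if $L=s^{-1}(P)$ for some stamp $s:A^*\twoheadrightarrow M$ in $\mathbf V$ and some $P\subseteq M$; 3. a finite action over $A$ is in $\Psi(\mathbf V)$ if and only if the stamp of $A^*$ onto its transformation monoid is in $\mathbf V$; and a stamp $s:A^*\twoheadrightarrow M$ is in $\Psi^{-1}(\mathscr V)$ if and only if the action $m\cdot u=m\,s(u)$ of $A^*$ on $M$ is in $\mathscr V$; 4. a finite action on $S$ over $A$ is in $\Psi(\Phi(\mathcal V))$ if and only if $\{u\in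 A^*\mid \xi\cdot u\in F\}\in\mathcal V$ for every $\xi\in S$ and $F\subseteq S$; and $L\subseteq A^*$ is in $(\Psi\circ\Phi)^{-1}(\mathscr V)$ if and only if $L=\{u\in A^*\mid \xi\cdot u\in F\}$ for some action in $\mathscr V$ over $A$ on a set $S$, some $\xi\in S$ and some $F\subseteq S$. -/

import Mathlib

universe u

open CategoryTheory

/-- An object of the category `Free.Mon` of free monoids `A*` over alphabets `A`, i.e. over
finite non-empty sets.  The object `A*` is given by its alphabet. -/
structure FreeMon : Type (u + 1) where
  letters : Type u
  [fin : Finite letters]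
  [ne : Nonempty letters]

attribute [instance] FreeMon.fin FreeMon.ne

namespace FreeMon

/-- The free monoid `A*` of finite words over `A`. -/
abbrev Words (A : FreeMon.{u}) : Type u := FreeMonoid A.letters

/-- Morphisms are all monoid homomorphisms between free monoids.  A subcategory of `Free.Mon` with
all objects is a `W : MorphismProperty FreeMon` with `W.IsMultiplicative`
(it contains the identities and is closed under composition). -/
instance : Category FreeMon.{u} where
  Hom A B := A.Words →* B.Words
  id A := MonoidHom.id A.Words
  comp f g := MonoidHom.comp g f

/-- The monoid homomorphism underlying a morphism. -/
abbrev toMonoidHom {A B : FreeMon.{u}} (f : A ⟶ B) : A.Words →* B.Words := f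

end FreeMon

/-! ### Varieties of regular languages -/

namespace Language

/-- The right quotient `L w⁻¹ = {u | u w ∈ L}`. -/
def rightQuotient {α : Type u} (L : Language α) (w : List α) : Language α :=
  {v | v ++ w ∈ L}

/-- The inverse image `f⁻¹ L` of a language under a homomorphism of free monoids. -/
def invImage {α β : Type u} (f : FreeMonoid α →* FreeMonoid β) (L : Language β) : Language α :=
  {w | (f (FreeMonoid.ofList w)).toList ∈ L}

theorem isRegular_leftQuotient {α : Type u} {L : Language α} (h : L.IsRegular) (w : List α) :
    (L.leftQuotient w).IsRegular := by
  obtain ⟨σ, hσ, M, rfl⟩ := h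
  refine ⟨σ, hσ, ⟨M.step, M.eval w, M.accept⟩, ?_⟩
  rw [leftQuotient_accepts_apply]
  rfl

theorem isRegular_rightQuotient {α : Type u} {L : Language α} (h : L.IsRegular) (w : List α) :
    (L.rightQuotient w).IsRegular := by
  obtain ⟨σ, hσ, M, rfl⟩ := h
  refine ⟨σ, hσ, ⟨M.step, M.start, {q | M.evalFrom q w ∈ M.accept}⟩, ?_⟩
  ext v
  change M.evalFrom (M.evalFrom M.start v) w ∈ M.accept ↔ M.evalFrom M.start (v ++ w) ∈ M.accept
  rw [DFA.evalFrom_of_append]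

theorem isRegular_invImage {α β : Type u} (f : FreeMonoid α →* FreeMonoid β) {L : Language β}
    (h : L.IsRegular) : (invImage f L).IsRegular := by
  obtain ⟨σ, hσ, M, rfl⟩ := h
  let N : DFA α σ :=
    ⟨fun q a => M.evalFrom q (f (FreeMonoid.of a)).toList, M.start, M.accept⟩
  have key : ∀ (v : List α) (q : σ),
      N.evalFrom q v = M.evalFrom q (f (FreeMonoid.ofList v)).toList := by
    intro v
    induction v with
    | nil => intro q; simp
    | cons a v ih =>
      intro q
      rw [DFA.evalFrom_cons, ih, FreeMonoid.ofList_cons, map_mul, FreeMonoid.toList_mul,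
        DFA.evalFrom_of_append]
  refine ⟨σ, hσ, N, ?_⟩
  ext v
  change N.evalFrom M.start v ∈ M.accept ↔
    M.evalFrom M.start (f (FreeMonoid.ofList v)).toList ∈ M.accept
  rw [key]

theorem isRegular_bot {α : Type u} : (⊥ : Language α).IsRegular :=
  ⟨Unit, inferInstance, ⟨fun _ _ => (), (), ∅⟩, by ext v; exact Iff.rfl⟩

end Language

/-- A `C`-variety of regular languages, where `C` is the subcategory of `Free.Mon` with
morphisms `W`. -/
@[ext]
structure LanguageVariety (W : MorphismProperty FreeMon.{u}) : Type (u + 1) where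
  /-- the languages over the alphabet `A` that belong to the variety -/
  lang : ∀ A : FreeMon.{u}, Set (Language A.letters)
  regular : ∀ {A : FreeMon.{u}} {L : Language A.letters}, L ∈ lang A → L.IsRegular
  empty_mem : ∀ A : FreeMon.{u}, (⊥ : Language A.letters) ∈ lang A
  univ_mem : ∀ A : FreeMon.{u}, (⊤ : Language A.letters) ∈ lang A
  union_mem : ∀ {A : FreeMon.{u}} {L R : Language A.letters},
    L ∈ lang A → R ∈ lang A → L ⊔ R ∈ lang A
  inter_mem : ∀ {A : FreeMon.{u}} {L R : Language A.letters},
    L ∈ lang A → R ∈ lang A → L ⊓ R ∈ lang A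
  compl_mem : ∀ {A : FreeMon.{u}} {L : Language A.letters}, L ∈ lang A → Lᶜ ∈ lang A
  leftQuotient_mem : ∀ {A : FreeMon.{u}} {L : Language A.letters} (w : List A.letters),
    L ∈ lang A → L.leftQuotient w ∈ lang A
  rightQuotient_mem : ∀ {A : FreeMon.{u}} {L : Language A.letters} (w : List A.letters),
    L ∈ lang A → L.rightQuotient w ∈ lang A
  invImage_mem : ∀ {A B : FreeMon.{u}} (f : A ⟶ B), W f → ∀ {L : Language B.letters},
    L ∈ lang B → Language.invImage (FreeMon.toMonoidHom f) L ∈ lang A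

namespace LanguageVariety

variable {W : MorphismProperty FreeMon.{u}}

/-- Varieties are ordered by inclusion. -/
instance : PartialOrder (LanguageVariety W) :=
  PartialOrder.lift LanguageVariety.lang (fun _ _ h => LanguageVariety.ext h)

/-- The intersection of a set of varieties (inside the class of all regular languages). -/
instance : InfSet (LanguageVariety W) where
  sInf S :=
    { lang := fun A => {L | L.IsRegular ∧ ∀ V ∈ S, L ∈ V.lang A}
      regular := fun h => h.1
      empty_mem := fun A => ⟨Language.isRegular_bot, fun V _ => V.empty_mem A⟩
      univ_mem := fun A =>
        ⟨by simpa using (Language.isRegular_bot (α := A.letters)).compl, fun V _ => V.univ_mem A⟩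
      union_mem := fun h k => ⟨h.1.add k.1, fun V hV => V.union_mem (h.2 V hV) (k.2 V hV)⟩
      inter_mem := fun h k => ⟨h.1.inf k.1, fun V hV => V.inter_mem (h.2 V hV) (k.2 V hV)⟩
      compl_mem := fun h => ⟨h.1.compl, fun V hV => V.compl_mem (h.2 V hV)⟩
      leftQuotient_mem := fun w h =>
        ⟨Language.isRegular_leftQuotient h.1 w, fun V hV => V.leftQuotient_mem w (h.2 V hV)⟩
      rightQuotient_mem := fun w h =>
        ⟨Language.isRegular_rightQuotient h.1 w, fun V hV => V.rightQuotient_mem w (h.2 V hV)⟩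
      invImage_mem := fun f hf _ h =>
        ⟨Language.isRegular_invImage _ h.1, fun V hV => V.invImage_mem f hf (h.2 V hV)⟩ }

/-- The lattice of `C`-varieties of regular languages, ordered by inclusion. -/
instance : CompleteLattice (LanguageVariety W) :=
  completeLatticeOfInf _ fun _ =>
    ⟨fun V hV _ _ hL => hL.2 V hV, fun V hV A L hL =>
      show L.IsRegular ∧ _ from ⟨V.regular hL, fun _ hU => hV hU A hL⟩⟩

end LanguageVariety

/-! ### Varieties of finite stamps -/

/-- A finite stamp: a surjective homomorphism from `A*` onto a finite monoid. -/
structure Stamp (A : FreeMon.{u}) : Type (u + 1) where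
  M : Type u
  [monoid : Monoid M]
  [finite : Finite M]
  hom : A.Words →* M
  surj : Function.Surjective hom

namespace Stamp

attribute [instance] Stamp.monoid Stamp.finite

variable {A B : FreeMon.{u}}

/-- The stamp onto the one-element monoid. -/
def trivial (A : FreeMon.{u}) : Stamp A where
  M := PUnit.{u + 1}
  hom := 1
  surj := fun _ => ⟨1, rfl⟩

/-- The product `s * t`: the corestriction of `⟨s, t⟩` to its image in `M × N`. -/
def prod (s t : Stamp A) : Stamp A where
  M := MonoidHom.mrange (s.hom.prod t.hom)
  hom := (s.hom.prod t.hom).mrangeRestrict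
  surj := (s.hom.prod t.hom).mrangeRestrict_surjective

/-- `t = h ∘ s` for a surjective homomorphism `h`. -/
def IsQuotient (t s : Stamp A) : Prop :=
  ∃ h : s.M →* t.M, Function.Surjective h ∧ t.hom = h.comp s.hom

/-- `j ∘ s = t ∘ f` for an injective homomorphism `j`. -/
def EmbedsAlong (f : A.Words →* B.Words) (s : Stamp A) (t : Stamp B) : Prop :=
  ∃ j : s.M →* t.M, Function.Injective j ∧ j.comp s.hom = t.hom.comp f

/-- The language `s⁻¹ P` recognized by `s` and a subset `P` of its monoid. -/
def preimage (s : Stamp A) (P : Set s.M) : Language A.letters :=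
  {w | s.hom (FreeMonoid.ofList w) ∈ P}

/-- `s` is (up to isomorphism) the quotient of `A*` by the syntactic congruence of `L`, i.e. the
projection of `A*` onto the syntactic monoid of `L`. -/
def IsSyntacticOf (s : Stamp A) (L : Language A.letters) : Prop :=
  ∀ u v : A.Words, s.hom u = s.hom v ↔
    ∀ x y : A.Words, (x * u * y).toList ∈ L ↔ (x * v * y).toList ∈ L

end Stamp

/-- A `C`-variety of finite stamps, where `C` is the subcategory of `Free.Mon` with
morphisms `W`. -/
@[ext]
structure StampVariety (W : MorphismProperty FreeMon.{u}) : Type (u + 1) where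
  /-- the stamps over the alphabet `A` that belong to the variety -/
  stamps : ∀ A : FreeMon.{u}, Set (Stamp A)
  trivial_mem : ∀ A : FreeMon.{u}, Stamp.trivial A ∈ stamps A
  prod_mem : ∀ {A : FreeMon.{u}} {s t : Stamp A},
    s ∈ stamps A → t ∈ stamps A → s.prod t ∈ stamps A
  quotient_mem : ∀ {A : FreeMon.{u}} {s t : Stamp A},
    s ∈ stamps A → t.IsQuotient s → t ∈ stamps A
  pullback_mem : ∀ {A B : FreeMon.{u}} (f : A ⟶ B), W f → ∀ {t : Stamp B} {s : Stamp A},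
    t ∈ stamps B → Stamp.EmbedsAlong (FreeMon.toMonoidHom f) s t → s ∈ stamps A

namespace StampVariety

variable {W : MorphismProperty FreeMon.{u}}

/-- Varieties are ordered by inclusion. -/
instance : PartialOrder (StampVariety W) :=
  PartialOrder.lift StampVariety.stamps (fun _ _ h => StampVariety.ext h)

/-- The intersection of a set of varieties. -/
instance : InfSet (StampVariety W) where
  sInf S :=
    { stamps := fun A => {s | ∀ V ∈ S, s ∈ V.stamps A}
      trivial_mem := fun A V _ => V.trivial_mem A
      prod_mem := fun h k V hV => V.prod_mem (h V hV) (k V hV)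
      quotient_mem := fun h q V hV => V.quotient_mem (h V hV) q
      pullback_mem := fun f hf _ _ h e V hV => V.pullback_mem f hf (h V hV) e }

/-- The lattice of `C`-varieties of finite stamps, ordered by inclusion. -/
instance : CompleteLattice (StampVariety W) :=
  completeLatticeOfInf _ fun _ =>
    ⟨fun V hV _ _ hs => hs V hV, fun _ hV A _ hs _ hU => hV hU A hs⟩

end StampVariety

/-! ### Varieties of finite actions -/

/-- A finite action `S × A* → S` (a deterministic finite automaton without initial and final
states). The state set may be empty. -/
structure FinAction (A : FreeMon.{u}) : Type (u + 1) where
  S : Type u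
  [finite : Finite S]
  act : S → A.Words → S
  act_mul : ∀ (q : S) (v w : A.Words), act (act q v) w = act q (v * w)
  act_one : ∀ q : S, act q 1 = q

namespace FinAction

attribute [instance] FinAction.finite

variable {A B : FreeMon.{u}}

/-- An action in which every word fixes every state. -/
def IsTrivial (s : FinAction A) : Prop :=
  ∀ (q : s.S) (w : A.Words), s.act q w = q

/-- The product action on `S × T`. -/
def prod (s t : FinAction A) : FinAction A where
  S := s.S × t.S
  act q w := (s.act q.1 w, t.act q.2 w)
  act_mul q v w := by simp [s.act_mul, t.act_mul]
  act_one q := by simp [s.act_one, t.act_one]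

/-- The subaction on a set of states that is closed under the action. -/
def restrict (s : FinAction A) (T : Set s.S) (hT : ∀ q ∈ T, ∀ w : A.Words, s.act q w ∈ T) :
    FinAction A where
  S := T
  act q w := ⟨s.act q.1 w, hT q.1 q.2 w⟩
  act_mul q v w := Subtype.ext (s.act_mul q.1 v w)
  act_one q := Subtype.ext (s.act_one q.1)

/-- `t` is the image of `s` under a surjective equivariant map. -/
def IsQuotient (t s : FinAction A) : Prop :=
  ∃ p : s.S → t.S, Function.Surjective p ∧ ∀ (q : s.S) (w : A.Words),
    p (s.act q w) = t.act (p q) w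

/-- The action `f^* s` of `A*` obtained from an action `s` of `B*` along `f : A* → B*`. -/
def pullback (f : A.Words →* B.Words) (s : FinAction B) : FinAction A where
  S := s.S
  act q w := s.act q (f w)
  act_mul q v w := by rw [s.act_mul, map_mul]
  act_one q := by rw [map_one, s.act_one]

/-- The language of the automaton with transitions `s`, initial state `q` and set of final
states `F`. -/
def language (s : FinAction A) (q : s.S) (F : Set s.S) : Language A.letters :=
  {w | s.act q (FreeMonoid.ofList w) ∈ F}

/-- The homomorphism that sends a word to the transformation of the states it induces.
Transformations act on the right, so they are composed in the opposite order. -/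
def transformationHom (s : FinAction A) : A.Words →* (Function.End s.S)ᵐᵒᵖ where
  toFun w := MulOpposite.op (fun q => s.act q w)
  map_one' := congrArg MulOpposite.op (funext s.act_one)
  map_mul' v w := congrArg MulOpposite.op (funext fun q => (s.act_mul q v w).symm)

instance (s : FinAction A) : Finite (Function.End s.S)ᵐᵒᵖ :=
  have : Finite (Function.End s.S) := inferInstanceAs (Finite (s.S → s.S))
  Finite.of_equiv _ MulOpposite.opEquiv

/-- The stamp of `A*` onto the transformation monoid of a finite action. -/
def transformationStamp (s : FinAction A) : Stamp A where
  M := MonoidHom.mrange s.transformationHom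
  hom := s.transformationHom.mrangeRestrict
  surj := s.transformationHom.mrangeRestrict_surjective

end FinAction

/-- The action of `A*` on the monoid of a stamp `s` by `m · w = m s(w)`. -/
def Stamp.rightAction {A : FreeMon.{u}} (s : Stamp A) : FinAction A where
  S := s.M
  act m w := m * s.hom w
  act_mul m v w := by rw [map_mul, mul_assoc]
  act_one m := by rw [map_one, mul_one]

/-- A `C`-variety of finite actions, where `C` is the subcategory of `Free.Mon` with
morphisms `W`. -/
@[ext]
structure ActionVariety (W : MorphismProperty FreeMon.{u}) : Type (u + 1) where
  /-- the actions over the alphabet `A` that belong to the variety -/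
  actions : ∀ A : FreeMon.{u}, Set (FinAction A)
  trivial_mem : ∀ {A : FreeMon.{u}} {s : FinAction A}, s.IsTrivial → s ∈ actions A
  prod_mem : ∀ {A : FreeMon.{u}} {s t : FinAction A},
    s ∈ actions A → t ∈ actions A → s.prod t ∈ actions A
  restrict_mem : ∀ {A : FreeMon.{u}} {s : FinAction A} (T : Set s.S)
    (hT : ∀ q ∈ T, ∀ w : A.Words, s.act q w ∈ T), s ∈ actions A → s.restrict T hT ∈ actions A
  quotient_mem : ∀ {A : FreeMon.{u}} {s t : FinAction A},
    s ∈ actions A → t.IsQuotient s → t ∈ actions A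
  pullback_mem : ∀ {A B : FreeMon.{u}} (f : A ⟶ B), W f → ∀ {s : FinAction B},
    s ∈ actions B → FinAction.pullback (FreeMon.toMonoidHom f) s ∈ actions A

namespace ActionVariety

variable {W : MorphismProperty FreeMon.{u}}

/-- Varieties are ordered by inclusion. -/
instance : PartialOrder (ActionVariety W) :=
  PartialOrder.lift ActionVariety.actions (fun _ _ h => ActionVariety.ext h)

/-- The intersection of a set of varieties. -/
instance : InfSet (ActionVariety W) where
  sInf S :=
    { actions := fun A => {s | ∀ V ∈ S, s ∈ V.actions A}
      trivial_mem := fun h V _ => V.trivial_mem h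
      prod_mem := fun h k V hV => V.prod_mem (h V hV) (k V hV)
      restrict_mem := fun T hT h V hV => V.restrict_mem T hT (h V hV)
      quotient_mem := fun h q V hV => V.quotient_mem (h V hV) q
      pullback_mem := fun f hf _ h V hV => V.pullback_mem f hf (h V hV) }

/-- The lattice of `C`-varieties of finite actions, ordered by inclusion. -/
instance : CompleteLattice (ActionVariety W) :=
  completeLatticeOfInf _ fun _ =>
    ⟨fun V hV _ _ hs => hs V hV, fun _ hV A _ hs _ hU => hV hU A hs⟩

end ActionVariety

/-! Up to isomorphism a stamp is its kernel, a congruence of finite index on `A*`. Membership in a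
stamp variety passes to larger kernels (`StampVariety.mem_of_ker_le`) and to finite intersections of
kernels (`StampVariety.mem_of_separated`), so both isomorphisms reduce to asking which words are
identified.

Languages: a language that is a union of classes cut out by finitely many members of a variety is a
Boolean combination of them (`LanguageVariety.mem_of_separated`). The syntactic congruence of a
regular `L` is cut out by finitely many quotients `x⁻¹Ly⁻¹`, so the syntactic stamp of a member
recognizes only members. Conversely, a stamp is determined by its finitely many fibres, each
recognized by a stamp of the variety.

Actions: in a power of `S`, the tuple of all states has an orbit isomorphic to the right regular
action of the transformation monoid `M`. Conversely, `S` is the image of `S × M`, with trivial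
action on `S`, under evaluation (`rightAction_transformationStamp_mem_iff`). -/

/-! ### Comparing homomorphisms by their kernels -/

/-- A homomorphism factors through a surjective one with a smaller kernel. -/
theorem MonoidHom.exists_comp_eq_of_surjective {X M N : Type*} [Monoid X] [Monoid M] [Monoid N]
    (s : X →* M) (hs : Function.Surjective s) (g : X →* N)
    (h : ∀ u v, s u = s v → g u = g v) : ∃ k : M →* N, k.comp s = g := by
  have key : ∀ u, g (Function.surjInv hs (s u)) = g u := fun u =>
    h _ _ (Function.surjInv_eq hs (s u))
  refine ⟨⟨⟨fun m => g (Function.surjInv hs m), ?_⟩, ?_⟩, MonoidHom.ext key⟩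
  · rw [← map_one s, key, map_one]
  · intro m n
    obtain ⟨u, rfl⟩ := hs m
    obtain ⟨v, rfl⟩ := hs n
    change g (Function.surjInv hs (s u * s v)) =
      g (Function.surjInv hs (s u)) * g (Function.surjInv hs (s v))
    rw [← map_mul, key, key, key, map_mul]

namespace Stamp

variable {A B : FreeMon.{u}}

theorem isQuotient_of_ker_le {s t : Stamp A}
    (h : ∀ u v, s.hom u = s.hom v → t.hom u = t.hom v) : t.IsQuotient s := by
  obtain ⟨k, hk⟩ := MonoidHom.exists_comp_eq_of_surjective s.hom s.surj t.hom h
  refine ⟨k, fun m => ?_, hk.symm⟩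
  obtain ⟨u, rfl⟩ := t.surj m
  exact ⟨s.hom u, DFunLike.congr_fun hk u⟩

theorem embedsAlong_of_ker_eq {f : A.Words →* B.Words} {s : Stamp A} {t : Stamp B}
    (h : ∀ u v, s.hom u = s.hom v ↔ t.hom (f u) = t.hom (f v)) : EmbedsAlong f s t := by
  obtain ⟨j, hj⟩ := MonoidHom.exists_comp_eq_of_surjective s.hom s.surj (t.hom.comp f)
    (fun u v huv => (h u v).1 huv)
  refine ⟨j, fun m n hmn => ?_, hj⟩
  obtain ⟨u, rfl⟩ := s.surj m
  obtain ⟨v, rfl⟩ := s.surj n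
  have hu : j (s.hom u) = t.hom (f u) := DFunLike.congr_fun hj u
  have hv : j (s.hom v) = t.hom (f v) := DFunLike.congr_fun hj v
  rw [hu, hv] at hmn
  exact (h u v).2 hmn

theorem prod_hom_eq_iff (s t : Stamp A) (u v : A.Words) :
    (s.prod t).hom u = (s.prod t).hom v ↔ s.hom u = s.hom v ∧ t.hom u = t.hom v :=
  Subtype.ext_iff.trans Prod.ext_iff

/-- The corestriction to its image of a homomorphism into a finite monoid. -/
def ofHom {N : Type u} [Monoid N] [Finite N] (g : A.Words →* N) : Stamp A where
  M := MonoidHom.mrange g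
  hom := g.mrangeRestrict
  surj := g.mrangeRestrict_surjective

theorem ofHom_hom_eq_iff {N : Type u} [Monoid N] [Finite N] (g : A.Words →* N) (u v : A.Words) :
    (ofHom g).hom u = (ofHom g).hom v ↔ g u = g v :=
  Subtype.ext_iff

/-- A language saturated by the kernel of a stamp is recognized by it. -/
theorem eq_preimage_of_saturated (s : Stamp A) (L : Language A.letters)
    (h : ∀ u v : A.Words, s.hom u = s.hom v → u.toList ∈ L → v.toList ∈ L) :
    L = s.preimage {m | ∃ u : A.Words, s.hom u = m ∧ u.toList ∈ L} := by
  ext w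
  exact ⟨fun hw => ⟨FreeMonoid.ofList w, rfl, hw⟩, fun ⟨u, hu, huL⟩ => h u _ hu huL⟩

theorem isRegular_preimage (s : Stamp A) (P : Set s.M) : (s.preimage P).IsRegular := by
  -- The Cayley automaton of the stamp, started at the identity.
  let D : DFA A.letters s.M := ⟨fun m a => m * s.hom (FreeMonoid.of a), 1, P⟩
  have key : ∀ (w : List A.letters) (m : s.M),
      D.evalFrom m w = m * s.hom (FreeMonoid.ofList w) := by
    intro w
    induction w with
    | nil => intro m; simp
    | cons a w ih =>
      intro m
      rw [DFA.evalFrom_cons, ih, FreeMonoid.ofList_cons, map_mul, ← mul_assoc]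
  refine Language.isRegular_iff.2 ⟨s.M, Fintype.ofFinite _, D, ?_⟩
  ext w
  change D.evalFrom 1 w ∈ P ↔ s.hom (FreeMonoid.ofList w) ∈ P
  rw [key, one_mul]

end Stamp

namespace FinAction

variable {A : FreeMon.{u}}

theorem transformationStamp_hom_eq_iff (s : FinAction A) (u v : A.Words) :
    s.transformationStamp.hom u = s.transformationStamp.hom v ↔ ∀ q, s.act q u = s.act q v := by
  refine Subtype.ext_iff.trans ?_
  exact MulOpposite.op_injective.eq_iff.trans funext_iff

/-- The right regular action is faithful: the state `1` alone separates the elements of the monoid.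
-/
theorem transformationStamp_rightAction_hom_eq_iff (s : Stamp A) (u v : A.Words) :
    s.rightAction.transformationStamp.hom u = s.rightAction.transformationStamp.hom v ↔
      s.hom u = s.hom v := by
  rw [transformationStamp_hom_eq_iff]
  refine ⟨fun h => ?_, fun h (q : s.M) => congrArg (q * ·) h⟩
  have h1 : 1 * s.hom u = 1 * s.hom v := h (1 : s.M)
  rwa [one_mul, one_mul] at h1

theorem language_eq_preimage (s : FinAction A) (q : s.S) (F : Set s.S) :
    ∃ P, s.language q F = s.transformationStamp.preimage P :=
  ⟨_, s.transformationStamp.eq_preimage_of_saturated _ fun u v huv hu => by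
    change s.act q v ∈ F
    rw [← (s.transformationStamp_hom_eq_iff u v).1 huv q]
    exact hu⟩

end FinAction

/-! ### Syntactic stamps -/

namespace Language

/-- The syntactic congruence of a language. -/
def syntacticCon {A : FreeMon.{u}} (L : Language A.letters) : Con A.Words where
  r u v := ∀ x y : A.Words, (x * u * y).toList ∈ L ↔ (x * v * y).toList ∈ L
  iseqv := ⟨fun _ _ _ => Iff.rfl, fun h x y => (h x y).symm,
    fun h k x y => (h x y).trans (k x y)⟩
  mul' := by
    intro a b c d h k x y
    -- Replace `a` by `b` in the context `(x, c * y)`, then `c` by `d` in the context `(x * b, y)`.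
    have h1 := h x (c * y)
    have h2 := k (x * b) y
    simp only [← mul_assoc] at h1 h2 ⊢
    exact h1.trans h2

/-- A regular language is recognized by a stamp. -/
theorem IsRegular.exists_eq_preimage {A : FreeMon.{u}} {L : Language A.letters}
    (h : L.IsRegular) : ∃ (s : Stamp A) (P : Set s.M), L = s.preimage P := by
  obtain ⟨σ, _, D, rfl⟩ := isRegular_iff.{u, u}.1 h
  let s : FinAction A :=
    { S := σ
      act := fun q w => D.evalFrom q w.toList
      act_mul := fun q v w => (D.evalFrom_of_append q v.toList w.toList).symm
      act_one := fun q => rfl }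
  exact ⟨s.transformationStamp, s.language_eq_preimage D.start D.accept⟩

end Language

namespace Stamp

variable {A : FreeMon.{u}}

theorem mem_iff_of_hom_eq {s : Stamp A} {P : Set s.M} {u v : A.Words} (h : s.hom u = s.hom v)
    (x y : A.Words) :
    (x * u * y).toList ∈ s.preimage P ↔ (x * v * y).toList ∈ s.preimage P := by
  change s.hom (x * u * y) ∈ P ↔ s.hom (x * v * y) ∈ P
  simp only [map_mul, h]

/-- A language recognized by `s` has a syntactic stamp. -/
theorem exists_isSyntacticOf (s : Stamp A) (P : Set s.M) :
    ∃ t : Stamp A, t.IsSyntacticOf (s.preimage P) := by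
  -- The syntactic monoid is finite because it is an image of the finite monoid `s.M`.
  obtain ⟨k, hk⟩ := MonoidHom.exists_comp_eq_of_surjective s.hom s.surj
    (s.preimage P).syntacticCon.mk'
    (fun u v h => (Con.eq _).2 fun x y => mem_iff_of_hom_eq h x y)
  have hsurj : Function.Surjective k := fun m => by
    obtain ⟨u, rfl⟩ := Con.mk'_surjective m
    exact ⟨s.hom u, DFunLike.congr_fun hk u⟩
  have : Finite (s.preimage P).syntacticCon.Quotient := Finite.of_surjective k hsurj
  exact ⟨⟨(s.preimage P).syntacticCon.Quotient, (s.preimage P).syntacticCon.mk',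
    Con.mk'_surjective⟩, fun u v => Con.eq _⟩

/-- The syntactic congruence is the coarsest one saturating the language, so it contains the kernel
of every recognizing stamp. -/
theorem IsSyntacticOf.isQuotient {s t : Stamp A} {P : Set s.M}
    (h : t.IsSyntacticOf (s.preimage P)) : t.IsQuotient s :=
  isQuotient_of_ker_le fun u v huv => (h u v).2 fun x y => mem_iff_of_hom_eq huv x y

theorem IsSyntacticOf.exists_eq_preimage {t : Stamp A} {L : Language A.letters}
    (h : t.IsSyntacticOf L) : ∃ P, L = t.preimage P :=
  ⟨_, t.eq_preimage_of_saturated L fun u v huv hu => by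
    -- The empty context shows that the language is a union of classes.
    have := (h u v).1 huv 1 1
    simp only [one_mul, mul_one] at this
    exact this.1 hu⟩

end Stamp

/-! ### From languages to stamps -/

namespace LanguageVariety

variable {W : MorphismProperty FreeMon.{u}} (V : LanguageVariety W) {A : FreeMon.{u}}

theorem finite_inter_mem {C : Set (Language A.letters)} (hC : C.Finite) (h : C ⊆ V.lang A) :
    ({w | ∀ K ∈ C, w ∈ K} : Set (List A.letters)) ∈ V.lang A := by
  induction C, hC using Set.Finite.induction_on with
  | empty =>
    refine Set.mem_of_eq_of_mem (Language.ext fun w => ?_) (V.univ_mem A)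
    exact ⟨fun _ => trivial, fun _ K hK => hK.elim⟩
  | @insert K C _ _ ih =>
    refine Set.mem_of_eq_of_mem (Language.ext fun w => ?_)
      (V.inter_mem (h (Set.mem_insert K C)) (ih ((Set.subset_insert K C).trans h)))
    exact Set.forall_mem_insert

theorem finite_union_mem {C : Set (Language A.letters)} (hC : C.Finite) (h : C ⊆ V.lang A) :
    ({w | ∃ K ∈ C, w ∈ K} : Set (List A.letters)) ∈ V.lang A := by
  induction C, hC using Set.Finite.induction_on with
  | empty =>
    refine Set.mem_of_eq_of_mem (Language.ext fun w => ?_) (V.empty_mem A)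
    exact ⟨fun ⟨K, hK, _⟩ => hK.elim, fun h => h.elim⟩
  | @insert K C _ _ ih =>
    refine Set.mem_of_eq_of_mem (Language.ext fun w => ?_)
      (V.union_mem (h (Set.mem_insert K C)) (ih ((Set.subset_insert K C).trans h)))
    exact Set.exists_mem_insert

/-- A language whose words are told apart from the others by finitely many members of a variety is
a member as well. -/
theorem mem_of_separated {I : Type*} [Finite I] {K : I → Language A.letters}
    (hK : ∀ i, K i ∈ V.lang A) {L : Language A.letters}
    (h : ∀ u v : List A.letters, (∀ i, u ∈ K i ↔ v ∈ K i) → u ∈ L → v ∈ L) : L ∈ V.lang A := by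
  classical
  -- `D J` is the atom of the words that lie in `K i` exactly for `i ∈ J`; `L` is the union of the
  -- atoms that it meets.
  let E : Set I → I → Language A.letters := fun J i => if i ∈ J then K i else (K i)ᶜ
  let D : Set I → Language A.letters := fun J => {w | ∀ N ∈ Set.range (E J), w ∈ N}
  have hE : ∀ J i w, w ∈ E J i ↔ (w ∈ K i ↔ i ∈ J) := by
    intro J i w
    by_cases hi : i ∈ J
    · simp [E, hi]
    · simp only [E, hi, if_false, iff_false]
      exact Iff.rfl
  have hD : ∀ J w, w ∈ D J ↔ ∀ i, w ∈ K i ↔ i ∈ J := fun J w =>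
    Set.forall_mem_range.trans (forall_congr' fun i => hE J i w)
  have hDV : ∀ J, D J ∈ V.lang A := fun J => by
    refine V.finite_inter_mem (Set.finite_range _) ?_
    rintro _ ⟨i, rfl⟩
    by_cases hi : i ∈ J
    · simpa only [E, hi, if_true] using hK i
    · simpa only [E, hi, if_false] using V.compl_mem (hK i)
  refine Set.mem_of_eq_of_mem (Language.ext fun w => ?_)
    (V.finite_union_mem (C := D '' {J | ∃ u ∈ L, J = {i | u ∈ K i}}) (Set.toFinite _)
      (by rintro _ ⟨J, -, rfl⟩; exact hDV J))
  constructor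
  · exact fun hw => ⟨_, ⟨_, ⟨w, hw, rfl⟩, rfl⟩, (hD _ w).2 fun i => Iff.rfl⟩
  · rintro ⟨_, ⟨_, ⟨u, hu, rfl⟩, rfl⟩, hw⟩
    exact h u w (fun i => ((hD _ w).1 hw i).symm) hu

theorem preimage_mem_of_separated {I : Type*} [Finite I] {K : I → Language A.letters}
    (hK : ∀ i, K i ∈ V.lang A) {s : Stamp A}
    (h : ∀ u v : A.Words, (∀ i, u.toList ∈ K i ↔ v.toList ∈ K i) → s.hom u = s.hom v)
    (P : Set s.M) : s.preimage P ∈ V.lang A :=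
  V.mem_of_separated hK fun u v huv hu => by
    change s.hom (FreeMonoid.ofList v) ∈ P
    rw [← h (FreeMonoid.ofList u) (FreeMonoid.ofList v) huv]
    exact hu

/-- The stamps all of whose recognized languages belong to `V`. -/
def toStampVariety : StampVariety W where
  stamps A := {s | ∀ P : Set s.M, s.preimage P ∈ V.lang A}
  trivial_mem A P :=
    V.mem_of_separated (I := Empty) (K := Empty.elim) (fun i => i.elim) fun _ _ _ h => h
  prod_mem {A s t} hs ht P := by
    -- The fibres of `s` and of `t` together separate the classes of the product.
    refine V.preimage_mem_of_separated (I := s.M ⊕ t.M)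
      (K := Sum.elim (fun m => s.preimage {m}) (fun n => t.preimage {n})) ?_ ?_ P
    · rintro (m | n)
      · exact hs {m}
      · exact ht {n}
    · intro u v h
      exact (Stamp.prod_hom_eq_iff s t u v).2
        ⟨((h (Sum.inl (s.hom u))).1 rfl).symm, ((h (Sum.inr (t.hom u))).1 rfl).symm⟩
  quotient_mem {A s t} hs := by
    rintro ⟨k, -, hk⟩ P
    refine Set.mem_of_eq_of_mem (Language.ext fun w => ?_) (hs (k ⁻¹' P))
    change t.hom _ ∈ P ↔ k (s.hom _) ∈ P
    rw [hk, MonoidHom.comp_apply]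
  pullback_mem {A B} f hf {t s} ht := by
    rintro ⟨j, hj, hjs⟩ P
    -- Since `j` is injective, `s⁻¹ P = f⁻¹ (t⁻¹ (j P))`.
    refine Set.mem_of_eq_of_mem (Language.ext fun w => ?_) (V.invImage_mem f hf (ht (j '' P)))
    change s.hom _ ∈ P ↔ (t.hom.comp (FreeMon.toMonoidHom f)) _ ∈ j '' P
    rw [← hjs]
    exact hj.mem_set_image.symm

/-- The syntactic stamp of a member of `V` recognizes members of `V` only. -/
theorem mem_toStampVariety_of_isSyntacticOf {L : Language A.letters} (hL : L ∈ V.lang A)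
    {s : Stamp A} (hs : s.IsSyntacticOf L) : s ∈ V.toStampVariety.stamps A := by
  let r : s.M → A.Words := Function.surjInv s.surj
  have hr : ∀ m, s.hom (r m) = m := Function.surjInv_eq s.surj
  obtain ⟨Q, rfl⟩ := hs.exists_eq_preimage
  -- A context `(x, y)` matters only through its images in `s.M`, so one representative `r m` for
  -- each element leaves finitely many quotients to consider.
  refine V.preimage_mem_of_separated (I := s.M × s.M)
    (K := fun p => ((s.preimage Q).leftQuotient (r p.1).toList).rightQuotient (r p.2).toList)
    (fun p => V.rightQuotient_mem _ (V.leftQuotient_mem _ hL)) ?_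
  intro u v h
  refine (hs u v).2 fun x y => ?_
  have key : s.hom (r (s.hom x) * (u * r (s.hom y))) ∈ Q ↔
      s.hom (r (s.hom x) * (v * r (s.hom y))) ∈ Q := h (s.hom x, s.hom y)
  simp only [map_mul, hr] at key
  change s.hom (x * u * y) ∈ Q ↔ s.hom (x * v * y) ∈ Q
  simpa only [map_mul, mul_assoc] using key

end LanguageVariety

/-! ### From stamps to languages -/

namespace StampVariety

variable {W : MorphismProperty FreeMon.{u}} (V : StampVariety W)
  {A : FreeMon.{u}}

/-- The kernel of a product is the intersection of the kernels, so `s` is a quotient of the iterated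
product of the `t i`. -/
theorem mem_of_separated {I : Type*} [Finite I] {t : I → Stamp A}
    (ht : ∀ i, t i ∈ V.stamps A) {s : Stamp A}
    (h : ∀ u v, (∀ i, (t i).hom u = (t i).hom v) → s.hom u = s.hom v) : s ∈ V.stamps A := by
  have key : ∀ C : Set I, C.Finite → ∃ r ∈ V.stamps A,
      ∀ u v, r.hom u = r.hom v → ∀ i ∈ C, (t i).hom u = (t i).hom v := by
    intro C hC
    induction C, hC using Set.Finite.induction_on with
    | empty => exact ⟨_, V.trivial_mem A, fun _ _ _ i hi => hi.elim⟩
    | @insert i C _ _ ih =>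
      obtain ⟨r, hr, hrt⟩ := ih
      refine ⟨_, V.prod_mem (ht i) hr, fun u v huv => ?_⟩
      rw [Stamp.prod_hom_eq_iff] at huv
      exact Set.forall_mem_insert.2 ⟨huv.1, hrt u v huv.2⟩
  obtain ⟨r, hr, hrt⟩ := key Set.univ Set.finite_univ
  exact V.quotient_mem hr (Stamp.isQuotient_of_ker_le fun u v huv =>
    h u v fun i => hrt u v huv i trivial)

theorem mem_of_ker_le {s t : Stamp A} (hs : s ∈ V.stamps A)
    (h : ∀ u v, s.hom u = s.hom v → t.hom u = t.hom v) : t ∈ V.stamps A :=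
  V.quotient_mem hs (Stamp.isQuotient_of_ker_le h)

/-- The languages recognized by the stamps of `V`. -/
def toLanguageVariety : LanguageVariety W where
  lang A := {L | ∃ s ∈ V.stamps A, ∃ P : Set s.M, L = s.preimage P}
  regular := by
    rintro A _ ⟨s, -, P, rfl⟩
    exact s.isRegular_preimage P
  empty_mem A := ⟨_, V.trivial_mem A, ∅, rfl⟩
  univ_mem A := ⟨_, V.trivial_mem A, Set.univ, rfl⟩
  union_mem := by
    rintro A _ _ ⟨s, hs, P, rfl⟩ ⟨t, ht, Q, rfl⟩
    exact ⟨_, V.prod_mem hs ht, {m | m.1.1 ∈ P ∨ m.1.2 ∈ Q}, rfl⟩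
  inter_mem := by
    rintro A _ _ ⟨s, hs, P, rfl⟩ ⟨t, ht, Q, rfl⟩
    exact ⟨_, V.prod_mem hs ht, {m | m.1.1 ∈ P ∧ m.1.2 ∈ Q}, rfl⟩
  compl_mem := by
    rintro A _ ⟨s, hs, P, rfl⟩
    exact ⟨s, hs, Pᶜ, rfl⟩
  leftQuotient_mem := by
    rintro A _ w ⟨s, hs, P, rfl⟩
    refine ⟨s, hs, {m | s.hom (FreeMonoid.ofList w) * m ∈ P}, ?_⟩
    ext v
    change s.hom (FreeMonoid.ofList w * FreeMonoid.ofList v) ∈ P ↔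
      s.hom (FreeMonoid.ofList w) * s.hom (FreeMonoid.ofList v) ∈ P
    rw [map_mul]
  rightQuotient_mem := by
    rintro A _ w ⟨s, hs, P, rfl⟩
    refine ⟨s, hs, {m | m * s.hom (FreeMonoid.ofList w) ∈ P}, ?_⟩
    ext v
    change s.hom (FreeMonoid.ofList v * FreeMonoid.ofList w) ∈ P ↔
      s.hom (FreeMonoid.ofList v) * s.hom (FreeMonoid.ofList w) ∈ P
    rw [map_mul]
  invImage_mem := by
    rintro A B f hf _ ⟨t, ht, P, rfl⟩
    exact ⟨Stamp.ofHom (t.hom.comp (FreeMon.toMonoidHom f)),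
      V.pullback_mem f hf ht (Stamp.embedsAlong_of_ker_eq (Stamp.ofHom_hom_eq_iff _)),
      {m | m.1 ∈ P}, rfl⟩

theorem mem_toLanguageVariety_iff_isSyntacticOf (L : Language A.letters) :
    L ∈ V.toLanguageVariety.lang A ↔ ∃ s ∈ V.stamps A, s.IsSyntacticOf L := by
  constructor
  · rintro ⟨s, hs, P, rfl⟩
    obtain ⟨t, ht⟩ := s.exists_isSyntacticOf P
    exact ⟨t, V.quotient_mem hs ht.isQuotient, ht⟩
  · rintro ⟨s, hs, h⟩
    exact ⟨s, hs, h.exists_eq_preimage⟩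

theorem toStampVariety_toLanguageVariety : V.toLanguageVariety.toStampVariety = V := by
  ext A s
  constructor
  · intro hs
    -- Each fibre of `s` is recognized by some `t m` in `V`; words identified by all the `t m` lie
    -- in the same fibre.
    choose t ht P hP using fun m => hs {m}
    refine V.mem_of_separated ht fun u v huv => ?_
    have hu : u.toList ∈ s.preimage {s.hom u} := rfl
    rw [hP] at hu
    have hv : v.toList ∈ s.preimage {s.hom u} := by
      rw [hP]
      change (t (s.hom u)).hom v ∈ P (s.hom u)
      rw [← huv]
      exact hu
    exact hv.symm
  · exact fun hs P => ⟨s, hs, P, rfl⟩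

end StampVariety

/-- Regularity makes the syntactic stamp of a member finite, and this stamp witnesses the nontrivial
inclusion. -/
theorem LanguageVariety.toLanguageVariety_toStampVariety {W : MorphismProperty FreeMon.{u}}
    (V : LanguageVariety W) : V.toStampVariety.toLanguageVariety = V := by
  ext A L
  constructor
  · rintro ⟨s, hs, P, rfl⟩
    exact hs P
  · intro hL
    obtain ⟨s, P, rfl⟩ := (V.regular hL).exists_eq_preimage
    obtain ⟨t, ht⟩ := s.exists_isSyntacticOf P
    exact ⟨t, V.mem_toStampVariety_of_isSyntacticOf hL ht, ht.exists_eq_preimage⟩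

/-- The isomorphism between the lattices of varieties of languages and of stamps. -/
def languageStampIso (W : MorphismProperty FreeMon.{u}) :
    LanguageVariety W ≃o StampVariety W where
  toFun := LanguageVariety.toStampVariety
  invFun := StampVariety.toLanguageVariety
  left_inv := LanguageVariety.toLanguageVariety_toStampVariety
  right_inv := StampVariety.toStampVariety_toLanguageVariety
  map_rel_iff' {V V'} := by
    refine ⟨fun h => ?_, fun h A s hs P => h A (hs P)⟩
    -- The order is reflected because the inverse map is monotone.
    rw [← V.toLanguageVariety_toStampVariety, ← V'.toLanguageVariety_toStampVariety]
    rintro A L ⟨s, hs, hL⟩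
    exact ⟨s, h A hs, hL⟩

/-! ### From stamps to actions -/

namespace StampVariety

variable {W : MorphismProperty FreeMon.{u}} (V : StampVariety W)

open FinAction in
/-- The actions whose transformation monoids belong to `V`. -/
def toActionVariety : ActionVariety W where
  actions A := {s | s.transformationStamp ∈ V.stamps A}
  trivial_mem {A s} hs := V.mem_of_ker_le (V.trivial_mem A) fun u v _ =>
    (s.transformationStamp_hom_eq_iff u v).2 fun q => (hs q u).trans (hs q v).symm
  prod_mem {A s t} hs ht := V.mem_of_ker_le (V.prod_mem hs ht) fun u v h => by
    rw [Stamp.prod_hom_eq_iff, transformationStamp_hom_eq_iff, transformationStamp_hom_eq_iff] at h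
    rw [transformationStamp_hom_eq_iff]
    exact fun q => Prod.ext (h.1 q.1) (h.2 q.2)
  restrict_mem {A s} T hT hs := V.mem_of_ker_le hs fun u v h => by
    rw [transformationStamp_hom_eq_iff] at h ⊢
    exact fun q => Subtype.ext (h q.1)
  quotient_mem {A s t} hs := by
    rintro ⟨p, hp, hpa⟩
    refine V.mem_of_ker_le hs fun u v h => ?_
    rw [transformationStamp_hom_eq_iff] at h ⊢
    intro q
    obtain ⟨q, rfl⟩ := hp q
    rw [← hpa, ← hpa, h]
  pullback_mem {A B} f hf {s} hs := V.pullback_mem f hf hs (Stamp.embedsAlong_of_ker_eq fun u v => by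
    rw [transformationStamp_hom_eq_iff, transformationStamp_hom_eq_iff]
    exact Iff.rfl)

end StampVariety

namespace ActionVariety

variable {W : MorphismProperty FreeMon.{u}} (V : ActionVariety W) {A : FreeMon.{u}}

/-- The action on the monoid of a stamp is a quotient of the orbit of any state that separates
words at least as finely as the stamp. -/
theorem rightAction_mem_of_separated {t : FinAction A} (ht : t ∈ V.actions A) (p : t.S)
    {s : Stamp A} (h : ∀ u v, t.act p u = t.act p v → s.hom u = s.hom v) :
    s.rightAction ∈ V.actions A := by
  let O : Set t.S := Set.range (t.act p)
  have hO : ∀ q ∈ O, ∀ w, t.act q w ∈ O := by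
    rintro _ ⟨u, rfl⟩ w
    exact ⟨u * w, (t.act_mul p u w).symm⟩
  choose r hr using fun q : O => q.2
  -- The quotient map sends `p · u` to `s(u)`; by `h` it does not depend on the word `r` chosen to
  -- reach a state.
  refine V.quotient_mem (V.restrict_mem O hO ht) ⟨fun q => s.hom (r q), fun m => ?_, ?_⟩
  · obtain ⟨u, rfl⟩ := s.surj m
    exact ⟨⟨t.act p u, u, rfl⟩, h _ _ (hr _)⟩
  · intro q w
    change s.hom (r ((t.restrict O hO).act q w)) = s.hom (r q) * s.hom w
    rw [← map_mul]
    refine h _ _ ((hr _).trans ?_)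
    rw [← t.act_mul]
    exact congrArg (t.act · w) (hr q).symm

/-- The stamps whose actions on their monoids belong to `V`. -/
def toStampVariety : StampVariety W where
  stamps A := {s | s.rightAction ∈ V.actions A}
  trivial_mem A := V.trivial_mem fun _ _ => rfl
  prod_mem {A s t} hs ht :=
    V.rightAction_mem_of_separated (V.prod_mem hs ht) ((1 : s.M), (1 : t.M)) fun u v h => by
      have h1 : (1 * s.hom u, 1 * t.hom u) = (1 * s.hom v, 1 * t.hom v) := h
      simp only [one_mul, Prod.mk.injEq] at h1
      exact (Stamp.prod_hom_eq_iff s t u v).2 h1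
  quotient_mem {A s t} hs := by
    rintro ⟨k, -, hk⟩
    refine V.rightAction_mem_of_separated hs (1 : s.M) fun u v h => ?_
    have h1 : 1 * s.hom u = 1 * s.hom v := h
    rw [one_mul, one_mul] at h1
    rw [hk, MonoidHom.comp_apply, MonoidHom.comp_apply, h1]
  pullback_mem {A B} f hf {t s} ht := by
    rintro ⟨j, hj, hjs⟩
    refine V.rightAction_mem_of_separated (V.pullback_mem f hf ht) (1 : t.M) fun u v h => hj ?_
    have h1 : 1 * t.hom.comp (FreeMon.toMonoidHom f) u =
      1 * t.hom.comp (FreeMon.toMonoidHom f) v := h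
    rw [one_mul, one_mul, ← hjs] at h1
    exact h1

/-- A finite product of copies of an action contains a state separating all transformations. -/
theorem exists_separating_state {s : FinAction A} (hs : s ∈ V.actions A) :
    ∃ t ∈ V.actions A, ∃ p : t.S, ∀ u v, t.act p u = t.act p v → ∀ q, s.act q u = s.act q v := by
  have key : ∀ C : Set s.S, C.Finite → ∃ t ∈ V.actions A, ∃ p : t.S,
      ∀ u v, t.act p u = t.act p v → ∀ q ∈ C, s.act q u = s.act q v := by
    intro C hC
    induction C, hC using Set.Finite.induction_on with
    | empty =>
      -- The empty product: a one-point trivial action, which also provides a state when `s.S` is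
      -- empty.
      exact ⟨⟨PUnit, fun q _ => q, fun _ _ _ => rfl, fun _ => rfl⟩, V.trivial_mem fun _ _ => rfl,
        PUnit.unit, fun _ _ _ q hq => hq.elim⟩
    | @insert q C _ _ ih =>
      obtain ⟨t, ht, p, hp⟩ := ih
      refine ⟨_, V.prod_mem hs ht, (q, p), fun u v huv => ?_⟩
      have h1 := Prod.ext_iff.1 huv
      exact Set.forall_mem_insert.2 ⟨h1.1, hp u v h1.2⟩
  obtain ⟨t, ht, p, hp⟩ := key Set.univ Set.finite_univ
  exact ⟨t, ht, p, fun u v huv q => hp u v huv q trivial⟩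

theorem rightAction_transformationStamp_mem_iff (s : FinAction A) :
    s.transformationStamp.rightAction ∈ V.actions A ↔ s ∈ V.actions A := by
  constructor
  · intro h
    let s₀ : FinAction A := ⟨s.S, fun q _ => q, fun _ _ _ => rfl, fun _ => rfl⟩
    have h₀ : s₀ ∈ V.actions A := V.trivial_mem fun _ _ => rfl
    refine V.quotient_mem (V.prod_mem h₀ h)
      -- Evaluation `(q, m) ↦ q · m`. The trivial factor supplies one copy of the monoid for each
      -- starting state, so `s` need not be generated by a single state.
      ⟨fun x => (show s.transformationStamp.M from x.2).1.unop x.1, fun q => ?_, ?_⟩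
    · exact ⟨(q, (1 : s.transformationStamp.M)), rfl⟩
    · rintro ⟨q, m⟩ w
      rfl
  · intro h
    obtain ⟨t, ht, p, hp⟩ := V.exists_separating_state h
    exact V.rightAction_mem_of_separated ht p fun u v huv =>
      (s.transformationStamp_hom_eq_iff u v).2 (hp u v huv)

theorem toActionVariety_toStampVariety :
    V.toStampVariety.toActionVariety = V := by
  ext A s
  exact V.rightAction_transformationStamp_mem_iff s

end ActionVariety

theorem StampVariety.toStampVariety_toActionVariety {W : MorphismProperty FreeMon.{u}}
    (V : StampVariety W) : V.toActionVariety.toStampVariety = V := by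
  ext A s
  have key := FinAction.transformationStamp_rightAction_hom_eq_iff s
  exact ⟨fun h => V.mem_of_ker_le h fun u v => (key u v).1,
    fun h => V.mem_of_ker_le h fun u v => (key u v).2⟩

/-- The isomorphism between the lattices of varieties of stamps and of actions. -/
def stampActionIso (W : MorphismProperty FreeMon.{u}) :
    StampVariety W ≃o ActionVariety W where
  toFun := StampVariety.toActionVariety
  invFun := ActionVariety.toStampVariety
  left_inv := StampVariety.toStampVariety_toActionVariety
  right_inv := ActionVariety.toActionVariety_toStampVariety
  map_rel_iff' {V V'} := by
    refine ⟨fun h => ?_, fun h A s hs => h A hs⟩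
    rw [← V.toStampVariety_toActionVariety, ← V'.toStampVariety_toActionVariety]
    exact fun A s hs => h A hs

/-! ### Between languages and actions -/

theorem LanguageVariety.transformationStamp_mem_iff {W : MorphismProperty FreeMon.{u}}
    (V : LanguageVariety W) {A : FreeMon.{u}} (s : FinAction A) :
    s.transformationStamp ∈ V.toStampVariety.stamps A ↔
      ∀ (q : s.S) (F : Set s.S), s.language q F ∈ V.lang A := by
  constructor
  · intro h q F
    obtain ⟨P, hP⟩ := s.language_eq_preimage q F
    rw [hP]
    exact h P
  · intro h
    -- The finitely many languages `{u | q · u = q'}` determine the transformation induced by a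
    -- word.
    refine V.preimage_mem_of_separated (I := s.S × s.S) (K := fun x => s.language x.1 {x.2})
      (fun x => h _ _) fun u v huv => (s.transformationStamp_hom_eq_iff u v).2 fun q => ?_
    exact ((huv (q, s.act q u)).1 rfl).symm

theorem ActionVariety.mem_toLanguageVariety_iff {W : MorphismProperty FreeMon.{u}}
    (V : ActionVariety W) {A : FreeMon.{u}} (L : Language A.letters) :
    L ∈ V.toStampVariety.toLanguageVariety.lang A ↔
      ∃ s ∈ V.actions A, ∃ (q : s.S) (F : Set s.S), L = s.language q F := by
  constructor
  · rintro ⟨s, hs, P, rfl⟩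
    -- From the initial state `1`, a word leads to its image under `s`.
    refine ⟨s.rightAction, hs, (1 : s.M), P, ?_⟩
    ext w
    change s.hom (FreeMonoid.ofList w) ∈ P ↔ 1 * s.hom (FreeMonoid.ofList w) ∈ P
    rw [one_mul]
  · rintro ⟨s, hs, q, F, rfl⟩
    exact ⟨s.transformationStamp, (V.rightAction_transformationStamp_mem_iff s).2 hs,
      s.language_eq_preimage q F⟩

theorem mainTheorem9 (W : MorphismProperty FreeMon.{u}) [W.IsMultiplicative] :
    ∃ (Φ : LanguageVariety W ≃o StampVariety W) (Ψ : StampVariety W ≃o ActionVariety W),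
      -- between languages and stamps
      (∀ (V : LanguageVariety W) (A : FreeMon.{u}) (s : Stamp A),
        s ∈ (Φ V).stamps A ↔ ∀ P : Set s.M, s.preimage P ∈ V.lang A) ∧
      (∀ (V : StampVariety W) (A : FreeMon.{u}) (L : Language A.letters),
        L ∈ (Φ.symm V).lang A ↔ ∃ s ∈ V.stamps A, s.IsSyntacticOf L) ∧
      (∀ (V : StampVariety W) (A : FreeMon.{u}) (L : Language A.letters),
        L ∈ (Φ.symm V).lang A ↔ ∃ s ∈ V.stamps A, ∃ P : Set s.M, L = s.preimage P) ∧
      -- between stamps and actions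
      (∀ (V : StampVariety W) (A : FreeMon.{u}) (s : FinAction A),
        s ∈ (Ψ V).actions A ↔ s.transformationStamp ∈ V.stamps A) ∧
      (∀ (V : ActionVariety W) (A : FreeMon.{u}) (s : Stamp A),
        s ∈ (Ψ.symm V).stamps A ↔ s.rightAction ∈ V.actions A) ∧
      -- between languages and actions
      (∀ (V : LanguageVariety W) (A : FreeMon.{u}) (s : FinAction A),
        s ∈ ((Φ.trans Ψ) V).actions A ↔
          ∀ (q : s.S) (F : Set s.S), s.language q F ∈ V.lang A) ∧
      (∀ (V : ActionVariety W) (A : FreeMon.{u}) (L : Language A.letters),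
        L ∈ ((Φ.trans Ψ).symm V).lang A ↔
          ∃ s ∈ V.actions A, ∃ (q : s.S) (F : Set s.S), L = s.language q F) := by
  exact ⟨languageStampIso W, stampActionIso W,
    fun _ _ _ => Iff.rfl,
    fun V _ L => V.mem_toLanguageVariety_iff_isSyntacticOf L,
    fun _ _ _ => Iff.rfl,
    fun _ _ _ => Iff.rfl,
    fun _ _ _ => Iff.rfl,
    fun V _ s => V.transformationStamp_mem_iff s,
    fun V _ L => V.mem_toLanguageVariety_iff L⟩
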